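/- Let $G$ be a connected finite graph (loops and parallel edges are allowed) and let $T_0\subset G$ be a spanning tree, i.e. a subgraph with $V(T_0)=V(G)$ which is a tree (connected, without loops, and with a unique simple path between any two distinct vertices, paths being regarded as sequences of vertices and edges). Let $N=|E(G)\setminus E(T_0)|$ and choose a direction for each edge of $G$. For $e\in E(G)\setminus E(T_0)$ directed from $P$ to $Q$, let $D(e)\in C_1(T_0;\mathbb R)$ be $0$ if $P=Q$, and otherwise the $1$-chain of the unique simple path in $T_0$ from $Q$ to $P$ (each edge counted with sign $+1$ or $-1$ according as it is traversed along or against its direction). Let $Z[e]=e+D(e)\in C_1(G;\mathbb R)$, let $\mathrm{Mesh}=\mathrm{Mesh}(G,T_0)$ be the real $N\times N$ matrix with entries $\langle Z[e],Z[e']\rangle$, where $\langle\ ,\ \rangle$ is the inner product on $C_1(G;\mathbb R)$ for which the directed edges are orthonormal, let $Y$ be the $|E(T_0)|\times N$ matrix of $D$ in the bases of directed edges, and let $\mathrm{Mesh}^\#=Y^tY$. Let $ST(G)$ be the number of spanning trees of $G$, let $ST_j(G,T_0)$ be the number of spanning trees of $G$ containing exactly $j$ edges of $E(G)\setminus E(T_0)$,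 and let $ST(G,T_0)(U)=\sum_{j=0}^{N}(-1)^j\,ST_j(G,T_0)\,U^{N-j}$. Then: 1. $\mathrm{Mesh}=\mathrm{Id}+Y^tY$; all eigenvalues of $\mathrm{Mesh}^\#$ are real and $\ge 0$, and all eigenvalues of $\mathrm{Mesh}$ are real and $\ge 1$. 2. As polynomials in $U$, $$\det\big((U+1)\,\mathrm{Id}-\mathrm{Mesh}\big)=\det\big(U\,\mathrm{Id}-\mathrm{Mesh}^\#\big)=U^N+\sum_{j=1}^{N}(-1)^j\,ST_j(G,T_0)\,U^{N-j}=ST(G,T_0)(U).$$ 3. Equivalently, $\det(X\,\mathrm{Id}-\mathrm{Mesh})=ST(G,T_0)(X-1)$. 4. In particular, $\det(\mathrm{Mesh})=\sum_{j=0}^{N}ST_j(G,T_0)=ST(G)$. -/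

import Mathlib

open scoped Graph Matrix Polynomial

universe u v

namespace Graph

variable {α : Type u} {β : Type v}

/-! ### Walks, simple paths, trees

`Graph α β` is Mathlib's multigraph: loops and parallel edges are allowed. -/

/-- Walks in a multigraph. A walk records the edges that it uses, so that walks running through
the same vertices along different parallel edges are different. -/
inductive Walk (G : Graph α β) : α → α → Type (max u v)
  | nil {x : α} (hx : x ∈ V(G)) : Walk G x x
  | cons {x y z : α} (e : β) (h : G.IsLink e x y) (w : Walk G y z) : Walk G x z

/-- The list of vertices visited by a walk. -/
def Walk.support {G : Graph α β} : {x y : α} → G.Walk x y → List α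
  | x, _, .nil _ => [x]
  | x, _, .cons _ _ w => x :: w.support

/-- A simple path is a walk whose vertices are distinct. -/
def Walk.IsPath {G : Graph α β} {x y : α} (w : G.Walk x y) : Prop :=
  w.support.Nodup

/-- A graph is connected if any two distinct vertices are joined by a simple path. -/
def IsConnected (G : Graph α β) : Prop :=
  ∀ x ∈ V(G), ∀ y ∈ V(G), x ≠ y → ∃ w : G.Walk x y, w.IsPath

/-- A tree is a connected graph without loops in which any two distinct vertices are joined by a
unique simple path. (As paths record edges, a tree has no parallel edges.) -/
structure IsTree (T : Graph α β) : Prop where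
  connected : T.IsConnected
  loopless : T.Loopless
  path_unique : ∀ x ∈ V(T), ∀ y ∈ V(T), x ≠ y →
    ∀ w₁ w₂ : T.Walk x y, w₁.IsPath → w₂.IsPath → w₁ = w₂

/-- `T` is a spanning tree of `G`: a subgraph with the same vertices which is a tree. -/
structure IsSpanningTree (T G : Graph α β) : Prop where
  spanning : T ≤s G
  isTree : T.IsTree

/-! ### Counting spanning trees -/

/-- `ST(G)`, the number of spanning trees of `G`. -/
noncomputable def numSpanningTrees (G : Graph α β) : ℕ :=
  {T : Graph α β | T.IsSpanningTree G}.ncard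

/-- `ST_j(G, H)`, the number of spanning trees of `G` which contain precisely `j` edges of
`E(G) \ E(H)`. -/
noncomputable def numSpanningTreesOff (G H : Graph α β) (j : ℕ) : ℕ :=
  {T : Graph α β | T.IsSpanningTree G ∧ (E(T) ∩ (E(G) \ E(H))).ncard = j}.ncard

/-- The polynomial `ST(G, H)(X) = ∑_{j=0}^N (-1)^j ST_j(G, H) X^{N-j}`, `N = |E(G) \ E(H)|`. -/
noncomputable def spanningTreePoly (G H : Graph α β) : ℝ[X] :=
  ∑ j ∈ Finset.range ((E(G) \ E(H)).ncard + 1),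
    (-1) ^ j * (G.numSpanningTreesOff H j : ℝ[X]) *
      Polynomial.X ^ ((E(G) \ E(H)).ncard - j)

/-! ### Directions of edges and chains -/

/-- A choice of a direction (from `tail e` to `head e`) for each edge `e` of `G`. -/
structure Orientation (G : Graph α β) where
  tail : E(G) → α
  head : E(G) → α
  isLink : ∀ e : E(G), G.IsLink e (tail e) (head e)

/-- The induced directions of the edges of a subgraph. -/
def Orientation.restrict {T G : Graph α β} (o : G.Orientation) (h : T ≤ G) : T.Orientation where
  tail e := o.tail ⟨e, Graph.IsSubgraph.edgeSet_mono h e.2⟩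
  head e := o.head ⟨e, Graph.IsSubgraph.edgeSet_mono h e.2⟩
  isLink e := (Graph.IsSubgraph.isLink_iff h e.2).2 (o.isLink ⟨e, _⟩)

/-- The real 1-chains `C₁(F; ℝ)` on a set `F` of (directed) edges. -/
abbrev Chain (F : Set β) : Type v := F →₀ ℝ

/-- The intersection pairing on 1-chains, for which the directed edges are orthonormal. -/
noncomputable def Chain.pairing {F : Set β} (a b : Chain F) : ℝ :=
  a.sum fun e c => c * b e

open Classical in
/-- The 1-chain of a walk: the sum of the edges traversed, each with sign `+1` if it is traversed
along its chosen direction and `-1` if it is traversed against it. (It is used only for walks in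
trees, where there are no loops.) -/
noncomputable def Walk.chain {G : Graph α β} (o : G.Orientation) :
    {x y : α} → G.Walk x y → Chain E(G)
  | _, _, .nil _ => 0
  | x, _, .cons e h w =>
      Finsupp.single ⟨e, h.edge_mem⟩ (if o.tail ⟨e, h.edge_mem⟩ = x then 1 else -1) + w.chain o

/-- The unique simple path between two distinct vertices of a tree. -/
noncomputable def IsTree.path {T : Graph α β} (hT : T.IsTree) {x y : α}
    (hx : x ∈ V(T)) (hy : y ∈ V(T)) (hxy : x ≠ y) : T.Walk x y :=
  (hT.connected x hx y hy hxy).choose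

/-! ### The mesh matrix -/

namespace IsSpanningTree

variable {T G : Graph α β}

open Classical in
/-- `D(1 · e)` for an edge `e` of `G` outside `T`: zero if `e` is a loop, and otherwise the chain
of the simple path in `T` from the head of `e` to its tail. -/
noncomputable def edgeReturn (hT : T.IsSpanningTree G) (o : G.Orientation)
    (e : ↥(E(G) \ E(T))) : Chain E(T) :=
  if h : o.head ⟨e, e.2.1⟩ = o.tail ⟨e, e.2.1⟩ then 0
  else (hT.isTree.path
    (hT.spanning.vertexSet_eq ▸ (o.isLink ⟨e, e.2.1⟩).right_mem)
    (hT.spanning.vertexSet_eq ▸ (o.isLink ⟨e, e.2.1⟩).left_mem) h).chain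
      (o.restrict hT.spanning.le)

/-- The linear map `D : C₁(E(G - T); ℝ) → C₁(T; ℝ)`. -/
noncomputable def returnMap (hT : T.IsSpanningTree G) (o : G.Orientation) :
    Chain (E(G) \ E(T)) →ₗ[ℝ] Chain E(T) :=
  Finsupp.linearCombination ℝ (hT.edgeReturn o)

/-- The cycle `Z[e] = 1 · e + D(1 · e)`, a 1-chain of `G`. -/
noncomputable def cycle (hT : T.IsSpanningTree G) (o : G.Orientation)
    (e : ↥(E(G) \ E(T))) : Chain E(G) :=
  Finsupp.single ⟨e, e.2.1⟩ 1 +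
    (hT.returnMap o (Finsupp.single e 1)).mapDomain
      (Set.inclusion (Graph.IsSubgraph.edgeSet_mono hT.spanning.le))

/-- The mesh matrix `Mesh(G, T)`, with entries `⟨Z[e], Z[e']⟩`. -/
noncomputable def mesh (hT : T.IsSpanningTree G) (o : G.Orientation) :
    Matrix ↥(E(G) \ E(T)) ↥(E(G) \ E(T)) ℝ :=
  Matrix.of fun e e' => (hT.cycle o e).pairing (hT.cycle o e')

/-- The matrix `Y` of the linear map `D` in the bases of directed edges. -/
noncomputable def returnMatrix (hT : T.IsSpanningTree G) (o : G.Orientation) :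
    Matrix ↥E(T) ↥(E(G) \ E(T)) ℝ :=
  Matrix.of fun f e => hT.returnMap o (Finsupp.single e 1) f

/-- The reduced mesh matrix `Mesh^#(G, T) = Yᵗ Y`. -/
noncomputable def reducedMesh (hT : T.IsSpanningTree G) (o : G.Orientation) [Fintype ↥E(T)] :
    Matrix ↥(E(G) \ E(T)) ↥(E(G) \ E(T)) ℝ :=
  (hT.returnMatrix o)ᵀ * hT.returnMatrix o

end IsSpanningTree

end Graph

namespace Graph

variable {α : Type u} {β : Type v} {G T : Graph α β} {x y z : α}

/-! ### Walks and their chains -/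

namespace Walk

/-! Every edge of `G` has the same boundary as a unique chain of the spanning tree `T`. This
retracts the chains of `G` onto those of `T`, with matrix `R = [Id | -Y]` once the edges of `T` are
listed first. If edges outside `T` get weight `t` and the others weight `1`, with `W` the diagonal
matrix of weights, then `R W Rᵗ = Id + t Y Yᵗ`. Its determinant equals `det (Id + t Yᵗ Y)`, and
Cauchy–Binet expands it over maximal minors of `R`.

A minor is nonzero exactly when its columns are the edges of a spanning tree, and it is then `±1`,
being the determinant of an integer matrix with integer inverse. Hence `det (Id + t Mesh^#) = ∑ ST_j
t^j` (`det_one_add_smul_reducedMesh`). Putting `t = -1/U` gives the characteristic polynomial, `t =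
1` gives `det Mesh`, and `t = 0` gives `ST_0 = 1`.

The link with combinatorial trees is homological: a graph is a tree iff its boundary map is
injective and attains all differences of vertices (`boundary_injective`, `boundary_chain`,
`isTree_of_boundary`). -/

lemma start_mem_support (w : G.Walk x y) : x ∈ w.support := by
  cases w <;> simp [support]

lemma end_mem_support (w : G.Walk x y) : y ∈ w.support := by
  induction w with
  | nil => simp [support]
  | cons e h w ih => simp [support, ih]

lemma start_mem (w : G.Walk x y) : x ∈ V(G) := by
  cases w with
  | nil hx => exact hx
  | cons e h w => exact h.left_mem

lemma end_mem (w : G.Walk x y) : y ∈ V(G) := by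
  induction w with
  | nil hx => exact hx
  | cons e h w ih => exact ih

lemma IsPath.eq_nil {w : G.Walk x x} (hw : w.IsPath) : w = .nil w.start_mem := by
  cases w with
  | nil hx => rfl
  | cons e h w => exact absurd w.end_mem_support (List.nodup_cons.1 hw).1

/-- A walk can be split at every vertex that it visits. -/
lemma exists_split (o : G.Orientation) (w : G.Walk x y) (hz : z ∈ w.support) :
    ∃ (w₁ : G.Walk x z) (w₂ : G.Walk z y), w.chain o = w₁.chain o + w₂.chain o ∧
      w₁.support <+: w.support ∧ w₂.support <:+ w.support := by
  induction w with
  | @nil x hx =>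
    obtain rfl : z = x := by simpa [support] using hz
    exact ⟨.nil hx, .nil hx, by simp [chain], List.prefix_rfl, List.suffix_rfl⟩
  | @cons x x' y e h w ih =>
    by_cases hzx : z = x
    · subst hzx
      exact ⟨.nil h.left_mem, .cons e h w, by simp [chain], by simp [support],
        List.suffix_rfl⟩
    · obtain ⟨w₁, w₂, hc, h₁, h₂⟩ := ih (by simpa [support, hzx] using hz)
      exact ⟨.cons e h w₁, w₂, by simp [chain, hc, add_assoc], by simpa [support] using h₁,
        h₂.trans (List.suffix_cons _ _)⟩

/-- If the new first vertex already lies on the path, the final part of that path starting there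
does the job. -/
lemma exists_isPath (o : G.Orientation) (w : G.Walk x y) : ∃ p : G.Walk x y, p.IsPath := by
  induction w with
  | nil hx => exact ⟨.nil hx, by simp [IsPath, support]⟩
  | @cons x x' y e h w ih =>
    obtain ⟨p, hp⟩ := ih
    by_cases hx : x ∈ p.support
    · obtain ⟨-, q, -, -, hq⟩ := p.exists_split o hx
      exact ⟨q, hq.sublist.nodup hp⟩
    · exact ⟨.cons e h p, List.nodup_cons.2 ⟨hx, hp⟩⟩

lemma exists_intCast_eq_chain (o : G.Orientation) (w : G.Walk x y) (e : E(G)) :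
    ∃ n : ℤ, (n : ℝ) = w.chain o e := by
  classical
  induction w with
  | nil => exact ⟨0, by simp [chain]⟩
  | @cons x x' y f h w ih =>
    obtain ⟨n, hn⟩ := ih
    refine ⟨(if (⟨f, h.edge_mem⟩ : E(G)) = e then (if o.tail ⟨f, h.edge_mem⟩ = x then 1 else -1)
      else 0) + n, ?_⟩
    simp only [chain, Finsupp.add_apply, Finsupp.single_apply, ← hn]
    split_ifs <;> simp

/-- The chain of a walk does not involve the edges at a vertex that is not visited. -/
lemma chain_apply_eq_zero (o : G.Orientation) (w : G.Walk x y) {a b : α} {e : β}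
    (h : G.IsLink e a b) (ha : a ∉ w.support) : w.chain o ⟨e, h.edge_mem⟩ = 0 := by
  induction w with
  | nil => simp [chain]
  | @cons x x' y f hf w ih =>
    simp only [support, List.mem_cons, not_or] at ha
    have hfe : f ≠ e := by
      rintro rfl
      rcases h.left_eq_or_eq hf with rfl | rfl
      · exact ha.1 rfl
      · exact ha.2 w.start_mem_support
    simp [chain, ih ha.2, hfe]

/-- A simple path is determined by its chain. -/
lemma IsPath.eq_of_chain_eq (o : G.Orientation) {w₁ w₂ : G.Walk x y} (h₁ : w₁.IsPath)
    (h₂ : w₂.IsPath) (h : w₁.chain o = w₂.chain o) : w₁ = w₂ := by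
  induction w₁ with
  | nil hx => exact h₂.eq_nil.symm
  | @cons x x' y e he w₁ ih =>
    cases w₂ with
    | nil hx => exact h₁.eq_nil
    | @cons _ y' _ f hf w₂ =>
      obtain ⟨hx₁, hp₁⟩ := List.nodup_cons.1 h₁
      obtain ⟨hx₂, hp₂⟩ := List.nodup_cons.1 h₂
      by_cases hef : e = f
      · subst hef
        obtain rfl := he.right_unique hf
        rw [ih hp₁ hp₂ (by simpa [chain] using h)]
      -- The remainders of both paths avoid `x`, hence do not use `e`: its coefficient is `±1` in
      -- one chain and `0` in the other.
      · have := DFunLike.congr_fun h ⟨e, he.edge_mem⟩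
        simp only [chain, Finsupp.add_apply, chain_apply_eq_zero o w₁ he hx₁,
          chain_apply_eq_zero o w₂ he hx₂] at this
        split_ifs at this <;> simp [Ne.symm hef] at this

end Walk

/-! ### The boundary map -/

/-- The boundary of a 1-chain. -/
noncomputable def Orientation.boundary (o : G.Orientation) : Chain E(G) →ₗ[ℝ] (α →₀ ℝ) :=
  Finsupp.linearCombination ℝ fun e => Finsupp.single (o.head e) 1 - Finsupp.single (o.tail e) 1

lemma Orientation.boundary_single (o : G.Orientation) (e : E(G)) :
    o.boundary (Finsupp.single e 1) =
      Finsupp.single (o.head e) 1 - Finsupp.single (o.tail e) 1 := by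
  simp [boundary]

lemma Walk.boundary_chain (o : G.Orientation) (w : G.Walk x y) :
    o.boundary (w.chain o) = Finsupp.single y 1 - Finsupp.single x 1 := by
  induction w with
  | nil => simp [chain]
  | @cons x x' y e h w ih =>
    have hl := o.isLink ⟨e, h.edge_mem⟩
    simp only [chain, map_add, ih]
    split_ifs with ht
    · rw [o.boundary_single, ht]
      rw [ht] at hl
      rw [hl.right_unique h]
      abel
    · rw [Finsupp.single_neg, map_neg, o.boundary_single]
      obtain ⟨h₁, -⟩ | ⟨h₁, h₂⟩ := h.eq_and_eq_or_eq_and_eq hl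
      · exact absurd h₁.symm ht
      · rw [← h₁, ← h₂]
        abel

lemma IsConnected.exists_isPath (hG : G.IsConnected) (hx : x ∈ V(G)) (hy : y ∈ V(G)) :
    ∃ w : G.Walk x y, w.IsPath := by
  by_cases h : x = y
  · subst h
    exact ⟨.nil hx, by simp [Walk.IsPath, Walk.support]⟩
  · exact hG x hx y hy h

lemma IsTree.isPath_unique (hT : T.IsTree) {w₁ w₂ : T.Walk x y} (h₁ : w₁.IsPath)
    (h₂ : w₂.IsPath) : w₁ = w₂ := by
  by_cases h : x = y
  · subst h
    rw [h₁.eq_nil, h₂.eq_nil]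
  · exact hT.path_unique x w₁.start_mem y w₁.end_mem h w₁ w₂ h₁ h₂

/-- Either `q` runs through the tail of `e`, and uniqueness forces it to be `e` reversed followed by
`p`; or it does not, and `e` followed by `q` is a simple path, hence `p`. -/
lemma IsTree.chain_sub_chain (hT : T.IsTree) (o : T.Orientation) (e : E(T))
    {p : T.Walk (o.tail e) z} {q : T.Walk (o.head e) z} (hp : p.IsPath) (hq : q.IsPath) :
    p.chain o - q.chain o = Finsupp.single e 1 := by
  have hl := o.isLink e
  have hne : o.tail e ≠ o.head e := fun h => by
    rw [← h] at hl
    exact hT.loopless.not_isLoopAt _ _ hl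
  by_cases hmem : o.tail e ∈ q.support
  · obtain ⟨w₁, w₂, hc, h₁, h₂⟩ := q.exists_split o hmem
    have e₂ : w₂ = p := hT.isPath_unique (h₂.sublist.nodup hq) hp
    have e₁ : w₁ = .cons e hl.symm (.nil hl.left_mem) :=
      hT.isPath_unique (h₁.sublist.nodup hq)
        (by simpa [Walk.IsPath, Walk.support] using hne.symm)
    rw [hc, e₂, e₁]
    simp [Walk.chain, hne]
  · have e₁ : p = .cons e hl q := hT.isPath_unique hp (List.nodup_cons.2 ⟨hmem, hq⟩)
    rw [e₁]
    simp [Walk.chain]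

/-- A tree carries no cycles. -/
lemma IsTree.boundary_injective (hT : T.IsTree) (o : T.Orientation) :
    Function.Injective o.boundary := by
  classical
  rcases V(T).eq_empty_or_nonempty with hV | ⟨r, hr⟩
  · have : IsEmpty E(T) := ⟨fun e => by simpa [hV] using (o.isLink e).left_mem⟩
    exact Function.injective_of_subsingleton _
  choose p hp using fun (a : α) (ha : a ∈ V(T)) => hT.connected.exists_isPath ha hr
  -- A left inverse of the boundary: a vertex goes to minus the chain of its path to the root `r`.
  let P : (α →₀ ℝ) →ₗ[ℝ] Chain E(T) :=
    Finsupp.linearCombination ℝ fun a => if ha : a ∈ V(T) then -(p a ha).chain o else 0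
  have hP : P ∘ₗ o.boundary = LinearMap.id := by
    refine Finsupp.lhom_ext' fun e => LinearMap.ext_ring ?_
    have := hT.chain_sub_chain o e (hp _ (o.isLink e).left_mem) (hp _ (o.isLink e).right_mem)
    simp only [LinearMap.comp_apply, Finsupp.lsingle_apply, LinearMap.id_apply,
      o.boundary_single, map_sub, P, Finsupp.linearCombination_single, one_smul,
      dif_pos (o.isLink e).left_mem, dif_pos (o.isLink e).right_mem]
    rw [← this]
    abel
  exact Function.LeftInverse.injective (g := P) fun c => LinearMap.congr_fun hP c

/-- A graph whose boundary map is injective and whose boundaries include all differences of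
vertices is a tree. -/
lemma isTree_of_boundary (o : T.Orientation) (hinj : Function.Injective o.boundary)
    (hsurj : ∀ x ∈ V(T), ∀ y ∈ V(T),
      ∃ c, o.boundary c = Finsupp.single y 1 - Finsupp.single x 1) : T.IsTree where
  connected x hx y hy _ := by
    classical
    -- The indicator of the component of `y` kills all boundaries, but would be `1` on `y - x` if
    -- `x` were in another component.
    let φ : (α →₀ ℝ) →ₗ[ℝ] ℝ :=
      Finsupp.linearCombination ℝ fun a => if Nonempty (T.Walk a y) then 1 else 0
    have hφ : φ ∘ₗ o.boundary = 0 := by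
      refine Finsupp.lhom_ext' fun e => LinearMap.ext_ring ?_
      have : Nonempty (T.Walk (o.head e) y) ↔ Nonempty (T.Walk (o.tail e) y) :=
        ⟨fun ⟨w⟩ => ⟨.cons e (o.isLink e) w⟩, fun ⟨w⟩ => ⟨.cons e (o.isLink e).symm w⟩⟩
      simp [o.boundary_single, φ, this]
    obtain ⟨c, hc⟩ := hsurj x hx y hy
    have h0 : φ (o.boundary c) = 0 := LinearMap.congr_fun hφ c
    have hyy : Nonempty (T.Walk y y) := ⟨.nil hy⟩
    by_cases hw : Nonempty (T.Walk x y)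
    · exact hw.some.exists_isPath o
    · simp [hc, φ, hw, hyy] at h0
  loopless := ⟨fun e x hl => by
    have hl' := o.isLink ⟨e, hl.edge_mem⟩
    have h : o.head ⟨e, hl.edge_mem⟩ = o.tail ⟨e, hl.edge_mem⟩ :=
      (hl.eq_of_inc hl'.inc_right).symm.trans (hl.eq_of_inc hl'.inc_left)
    have : Finsupp.single (⟨e, hl.edge_mem⟩ : E(T)) (1 : ℝ) = 0 :=
      hinj (by rw [o.boundary_single, h, sub_self, map_zero])
    simp at this⟩
  path_unique x _ y _ _ w₁ w₂ h₁ h₂ :=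
    h₁.eq_of_chain_eq o h₂ (hinj (by rw [w₁.boundary_chain, w₂.boundary_chain]))

end Graph

/-! ### Linear algebra: Cauchy–Binet and the eigenvalues of Gram matrices. -/

namespace Matrix

variable {m n R : Type*} [Fintype m] [Fintype n] [CommRing R]

/-- The rows of `A * B` are combinations of the rows of `B`; expand by multilinearity. -/
lemma det_mul_eq_sum_functions [DecidableEq m] (A : Matrix m n R) (B : Matrix n m R) :
    (A * B).det = ∑ f : m → n, (∏ i, A i (f i)) * (B.submatrix f id).det := by
  have h : A * B = of fun i => ∑ k, A i k • B k := by
    ext i j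
    simp [mul_apply, Finset.sum_apply]
  rw [h]
  refine (MultilinearMap.map_sum (detRowAlternating (n := m) (R := R)).toMultilinearMap
    (fun i k => A i k • B k)).trans (Finset.sum_congr rfl fun f _ => ?_)
  exact MultilinearMap.map_smul_univ _ _ _

/-- The Cauchy–Binet formula, as a sum over all maps of the row indices to the column indices. -/
theorem factorial_mul_det_mul [DecidableEq m] (A : Matrix m n R) (B : Matrix n m R) :
    ((Fintype.card m).factorial : R) * (A * B).det =
      ∑ f : m → n, (A.submatrix id f).det * (B.submatrix f id).det := by
  calc ((Fintype.card m).factorial : R) * (A * B).det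
      = ∑ _σ : Equiv.Perm m, (A * B).det := by
        simp [Fintype.card_perm]
    -- For each `σ` the expansion is reindexed by `f ↦ f ∘ σ⁻¹`. Sorting the rows of `B` back yields
    -- the sign of `σ`, and the sum over `σ` then assembles the minor of `A`.
    _ = ∑ σ : Equiv.Perm m, ∑ f : m → n,
          (∏ i, A i (f (σ⁻¹ i))) * (B.submatrix (f ∘ ⇑σ⁻¹) id).det := by
        refine Finset.sum_congr rfl fun σ _ => ?_
        rw [det_mul_eq_sum_functions,
          ← (Equiv.arrowCongr σ (Equiv.refl n)).sum_comp]
        rfl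
    _ = ∑ f : m → n, ∑ σ : Equiv.Perm m,
          (Equiv.Perm.sign σ • ∏ i, A (σ i) (f i)) * (B.submatrix f id).det := by
        rw [Finset.sum_comm]
        refine Finset.sum_congr rfl fun f _ => Finset.sum_congr rfl fun σ _ => ?_
        have h₁ : ∏ i, A i (f (σ⁻¹ i)) = ∏ i, A (σ i) (f i) := by
          rw [← Equiv.prod_comp σ fun i => A i (f (σ⁻¹ i))]
          simp
        have h₂ := det_permute σ⁻¹ (B.submatrix f id)
        rw [submatrix_submatrix, Equiv.Perm.sign_inv] at h₂
        rw [h₁, show (id ∘ id : m → m) = id from rfl] at *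
        rw [h₂, Units.smul_def, zsmul_eq_mul]
        ring
    _ = _ := by
        refine Finset.sum_congr rfl fun f _ => ?_
        rw [← Finset.sum_mul, det_apply (A.submatrix id f)]
        rfl

lemma star_dotProduct_self_eq_sum_normSq (x : n → ℂ) :
    star x ⬝ᵥ x = ((∑ i, Complex.normSq (x i) : ℝ) : ℂ) := by
  simp [dotProduct, Complex.normSq_eq_conj_mul_self]

/-- For an eigenvector `v`, pairing `Yᵗ Y v = μ v` with `v` gives `|Y v|² = μ |v|²`, so `μ` is a
quotient of nonnegative reals. -/
lemma exists_nonneg_of_hasEigenvalue_transpose_mul_self [DecidableEq n] (Y : Matrix m n ℝ) (μ : ℂ)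
    (hμ : Module.End.HasEigenvalue (toLin' ((Yᵀ * Y).map (algebraMap ℝ ℂ))) μ) :
    ∃ r : ℝ, 0 ≤ r ∧ μ = (r : ℂ) := by
  obtain ⟨v, hv⟩ := hμ.exists_hasEigenvector
  have hA : (Yᵀ * Y).map (algebraMap ℝ ℂ) =
      (Y.map (algebraMap ℝ ℂ))ᴴ * Y.map (algebraMap ℝ ℂ) := by
    rw [Matrix.map_mul]
    congr 1
    ext i j
    simp
  have h₁ : star v ⬝ᵥ ((Yᵀ * Y).map (algebraMap ℝ ℂ) *ᵥ v) = μ * (star v ⬝ᵥ v) := by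
    have := hv.apply_eq_smul
    rw [toLin'_apply] at this
    rw [this, dotProduct_smul, smul_eq_mul]
  rw [hA, ← mulVec_mulVec, dotProduct_mulVec, ← star_mulVec, star_dotProduct_self_eq_sum_normSq,
    star_dotProduct_self_eq_sum_normSq] at h₁
  obtain ⟨i, hi⟩ := Function.ne_iff.1 hv.2
  have hpos : 0 < ∑ i, Complex.normSq (v i) :=
    Finset.sum_pos' (fun _ _ => Complex.normSq_nonneg _) ⟨i, Finset.mem_univ _,
      Complex.normSq_pos.2 hi⟩
  refine ⟨(∑ i, Complex.normSq ((Y.map (algebraMap ℝ ℂ) *ᵥ v) i)) / ∑ i, Complex.normSq (v i),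
    div_nonneg (Finset.sum_nonneg fun _ _ => Complex.normSq_nonneg _) hpos.le, ?_⟩
  rw [Complex.ofReal_div, h₁, mul_div_cancel_right₀ _ (Complex.ofReal_ne_zero.2 hpos.ne')]

lemma exists_one_le_of_hasEigenvalue_one_add [DecidableEq n] (Y : Matrix m n ℝ) (μ : ℂ)
    (hμ : Module.End.HasEigenvalue (toLin' ((1 + Yᵀ * Y).map (algebraMap ℝ ℂ))) μ) :
    ∃ r : ℝ, 1 ≤ r ∧ μ = (r : ℂ) := by
  obtain ⟨v, hv⟩ := hμ.exists_hasEigenvector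
  have hv' : Module.End.HasEigenvector (toLin' ((Yᵀ * Y).map (algebraMap ℝ ℂ))) (μ - 1) v := by
    refine ⟨Module.End.mem_eigenspace_iff.2 ?_, hv.2⟩
    have h := hv.apply_eq_smul
    rw [toLin'_apply, Matrix.map_add _ (map_add _),
      Matrix.map_one _ (map_zero _) (map_one _), add_mulVec, one_mulVec] at h
    rw [toLin'_apply, sub_smul, one_smul, ← h, add_sub_cancel_left]
  obtain ⟨r, hr, h⟩ := exists_nonneg_of_hasEigenvalue_transpose_mul_self Y _
    (Module.End.hasEigenvalue_of_hasEigenvector hv')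
  exact ⟨1 + r, by linarith, by push_cast; rw [← h]; ring⟩

end Matrix

/-! ### Boundaries on spanning trees. -/

namespace Graph

variable {α : Type u} {β : Type v} {G T T' : Graph α β}

lemma Orientation.boundary_restrict_single (o : G.Orientation) (h : T ≤ G) (e : E(T)) :
    (o.restrict h).boundary (Finsupp.single e 1) =
      o.boundary (Finsupp.single (Set.inclusion (IsSubgraph.edgeSet_mono h) e) 1) := by
  rw [boundary_single, boundary_single]
  rfl

namespace IsSpanningTree

lemma edgeSet_subset (hT : T.IsSpanningTree G) : E(T) ⊆ E(G) :=
  IsSubgraph.edgeSet_mono hT.spanning.le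

lemma boundary_injective (hT : T.IsSpanningTree G) (o : G.Orientation) :
    Function.Injective (o.restrict hT.spanning.le).boundary :=
  hT.isTree.boundary_injective _

/-- The chain of a path in `T` works. Integrality is what later makes the minors units rather than
merely nonzero. -/
lemma exists_intCast_boundary_eq (hT : T.IsSpanningTree G) (o : G.Orientation) {x y : α}
    (hx : x ∈ V(G)) (hy : y ∈ V(G)) : ∃ c : Chain E(T), (∀ e, ∃ n : ℤ, (n : ℝ) = c e) ∧
      (o.restrict hT.spanning.le).boundary c = Finsupp.single y 1 - Finsupp.single x 1 := by
  rw [← hT.spanning.vertexSet_eq] at hx hy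
  obtain ⟨w, -⟩ := hT.isTree.connected.exists_isPath hx hy
  exact ⟨_, w.exists_intCast_eq_chain _, w.boundary_chain _⟩

/-- All spanning trees have the same number of edges. -/
lemma natCard_edgeSet_eq (hT : T.IsSpanningTree G) (hT' : T'.IsSpanningTree G)
    (o : G.Orientation) : Nat.card E(T) = Nat.card E(T') := by
  -- The boundary maps the chains of `S` isomorphically onto the span of the differences of
  -- vertices, a space that depends on `G` only.
  have key {S : Graph α β} (hS : S.IsSpanningTree G) :
      Module.finrank ℝ (Submodule.span ℝ {p : α →₀ ℝ | ∃ x ∈ V(G), ∃ y ∈ V(G),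
        p = Finsupp.single y 1 - Finsupp.single x 1}) = Nat.card E(S) := by
    rw [← Module.finrank_eq_nat_card_basis (Finsupp.basisSingleOne (R := ℝ) (ι := E(S))),
      ← LinearMap.finrank_range_of_inj (hS.boundary_injective o)]
    refine congrArg (fun W : Submodule ℝ (α →₀ ℝ) => Module.finrank ℝ W)
      (le_antisymm (Submodule.span_le.2 ?_) ?_)
    · rintro _ ⟨x, hx, y, hy, rfl⟩
      obtain ⟨c, -, hc⟩ := hS.exists_intCast_boundary_eq o hx hy
      exact ⟨c, hc⟩
    · rw [Orientation.boundary, Finsupp.range_linearCombination]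
      refine Submodule.span_mono ?_
      rintro _ ⟨e, rfl⟩
      have hl := o.isLink (Set.inclusion hS.edgeSet_subset e)
      exact ⟨_, hl.left_mem, _, hl.right_mem, rfl⟩
  rw [← key hT, ← key hT']

/-! ### The retraction of the chains of the graph to those of a spanning tree -/

lemma boundary_edgeReturn (hT : T.IsSpanningTree G) (o : G.Orientation)
    (e : ↥(E(G) \ E(T))) :
    (o.restrict hT.spanning.le).boundary (hT.edgeReturn o e) =
      -o.boundary (Finsupp.single ⟨e, e.2.1⟩ 1) := by
  rw [o.boundary_single, edgeReturn]
  split_ifs with h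
  · simp [h]
  · rw [Walk.boundary_chain, neg_sub]

lemma exists_intCast_eq_edgeReturn (hT : T.IsSpanningTree G) (o : G.Orientation)
    (e : ↥(E(G) \ E(T))) (f : E(T)) : ∃ n : ℤ, (n : ℝ) = hT.edgeReturn o e f := by
  rw [edgeReturn]
  split_ifs with h
  · exact ⟨0, by simp⟩
  · exact Walk.exists_intCast_eq_chain _ _ _

open Classical in
/-- The chain of `T` with the same boundary as an edge of `G`. -/
noncomputable def retract (hT : T.IsSpanningTree G) (o : G.Orientation) (e : E(G)) : Chain E(T) :=
  if h : (e : β) ∈ E(T) then Finsupp.single ⟨e, h⟩ 1 else -hT.edgeReturn o ⟨e, e.2, h⟩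

lemma boundary_retract (hT : T.IsSpanningTree G) (o : G.Orientation) (e : E(G)) :
    (o.restrict hT.spanning.le).boundary (hT.retract o e) =
      o.boundary (Finsupp.single e 1) := by
  rw [retract]
  split_ifs with h
  · exact o.boundary_restrict_single _ _
  · rw [map_neg, hT.boundary_edgeReturn, neg_neg]

lemma exists_intCast_eq_retract (hT : T.IsSpanningTree G) (o : G.Orientation) (e : E(G))
    (f : E(T)) : ∃ n : ℤ, (n : ℝ) = hT.retract o e f := by
  classical
  rw [retract]
  split_ifs with h
  · exact ⟨if (⟨e, h⟩ : E(T)) = f then 1 else 0, by simp [Finsupp.single_apply]⟩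
  · obtain ⟨n, hn⟩ := hT.exists_intCast_eq_edgeReturn o ⟨e, e.2, h⟩ f
    exact ⟨-n, by simp [hn]⟩

/-- The matrix of the retraction of `C₁(G; ℝ)` to `C₁(T; ℝ)`. -/
noncomputable def retractMatrix (hT : T.IsSpanningTree G) (o : G.Orientation) :
    Matrix E(T) E(G) ℝ :=
  Matrix.of fun f e => hT.retract o e f

/-! ### Minors of the retraction matrix. -/

section Minors

variable [Fintype E(T)]

/-- The square submatrix of the retraction matrix on the edges of a subgraph of `G`. -/
noncomputable def minorMatrix (hT : T.IsSpanningTree G) (o : G.Orientation) (h : T' ≤ G)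
    (φ : E(T) ≃ E(T')) : Matrix E(T) E(T) ℝ :=
  (hT.retractMatrix o).submatrix id fun a => Set.inclusion (IsSubgraph.edgeSet_mono h) (φ a)

/-- The retraction preserves boundaries, and equality of chains of `T` can be tested on boundaries.
So the minor is the comparison of chains of `T'` with chains of `T` through their boundaries. -/
lemma minorMatrix_mulVec_eq_iff (hT : T.IsSpanningTree G) (o : G.Orientation) (h : T' ≤ G)
    (φ : E(T) ≃ E(T')) (c : Chain E(T')) (p : Chain E(T)) :
    hT.minorMatrix o h φ *ᵥ (c ∘ φ) = p ↔
      (o.restrict h).boundary c = (o.restrict hT.spanning.le).boundary p := by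
  have : Fintype E(T') := .ofEquiv _ φ
  set ι := Set.inclusion (IsSubgraph.edgeSet_mono h)
  set q : Chain E(T) := ∑ a, c (φ a) • hT.retract o (ι (φ a)) with hq
  have h₁ : hT.minorMatrix o h φ *ᵥ (c ∘ φ) = q := by
    ext f
    simp [hq, Matrix.mulVec, dotProduct, minorMatrix, retractMatrix, mul_comm, ι]
  have h₂ : (o.restrict h).boundary c = (o.restrict hT.spanning.le).boundary q := by
    have hc : c = ∑ e, c e • Finsupp.single e 1 := by
      simp
    conv_lhs => rw [hc]
    rw [← φ.sum_comp, map_sum, hq, map_sum]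
    refine Finset.sum_congr rfl fun a _ => ?_
    rw [map_smul, map_smul, boundary_retract, o.boundary_restrict_single]
  rw [h₁, h₂, (hT.boundary_injective o).eq_iff, DFunLike.coe_fn_eq]

variable [DecidableEq E(T)]

/-- The inverse matrix expresses each edge of `T` by the integral chain of `T'` with the same
boundary. Both matrices are integral, so the determinant is a unit of `ℤ`. -/
lemma det_minorMatrix_sq (hT : T.IsSpanningTree G) (hT' : T'.IsSpanningTree G)
    (o : G.Orientation) (φ : E(T) ≃ E(T')) :
    (hT.minorMatrix o hT'.spanning.le φ).det ^ 2 = 1 := by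
  have hc (e : E(T)) : ∃ c : Chain E(T'), (∀ f, ∃ n : ℤ, (n : ℝ) = c f) ∧
      (o.restrict hT'.spanning.le).boundary c =
        (o.restrict hT.spanning.le).boundary (Finsupp.single e 1) := by
    have hl := o.isLink (Set.inclusion hT.edgeSet_subset e)
    rw [o.boundary_restrict_single, o.boundary_single]
    exact hT'.exists_intCast_boundary_eq o hl.left_mem hl.right_mem
  choose c hint hc using hc
  choose N hN using hint
  choose M hM using fun e f => hT.exists_intCast_eq_retract o e f
  let A : Matrix E(T) E(T) ℤ :=
    Matrix.of fun i a => M (Set.inclusion hT'.edgeSet_subset (φ a)) i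
  let B : Matrix E(T) E(T) ℤ := Matrix.of fun a j => N j (φ a)
  have hA : A.map (Int.castRingHom ℝ) = hT.minorMatrix o hT'.spanning.le φ := by
    ext i a
    exact hM _ _
  have hAB : A * B = 1 := by
    apply Matrix.map_injective (Int.castRingHom ℝ).injective_int
    beta_reduce
    rw [Matrix.map_mul, Matrix.map_one _ (map_zero _) (map_one _), hA]
    ext i j
    have := congrFun ((hT.minorMatrix_mulVec_eq_iff o hT'.spanning.le φ (c j) _).2 (hc j)) i
    rw [Finsupp.single_apply] at this
    rw [Matrix.one_apply]
    simp only [eq_comm (a := i), ← this, Matrix.mul_apply, Matrix.mulVec, dotProduct]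
    simp [B, hN]
  have hdet : A.det * B.det = 1 := by rw [← Matrix.det_mul, hAB, Matrix.det_one]
  rw [← hA, ← RingHom.mapMatrix_apply, ← RingHom.map_det, ← map_pow,
    Int.isUnit_sq (IsUnit.of_mul_eq_one _ hdet), map_one]

/-- Invertibility transfers injectivity of the boundary, and attainment of all differences of
vertices, from `T` to `T'`; this is the homological criterion for a tree. -/
lemma isSpanningTree_of_det_minorMatrix_ne_zero (hT : T.IsSpanningTree G) (h : T' ≤s G)
    (o : G.Orientation) (φ : E(T) ≃ E(T')) (hdet : (hT.minorMatrix o h.le φ).det ≠ 0) :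
    T'.IsSpanningTree G where
  spanning := h
  isTree := by
    have : Fintype E(T') := .ofEquiv _ φ
    have hu : IsUnit (hT.minorMatrix o h.le φ).det := isUnit_iff_ne_zero.2 hdet
    refine isTree_of_boundary (o.restrict h.le) ?_ fun x hx y hy => ?_
    · refine (injective_iff_map_eq_zero _).2 fun c hc => ?_
      have h₀ := (hT.minorMatrix_mulVec_eq_iff o h.le φ c 0).2 (by rw [hc, map_zero])
      have h₁ := Matrix.eq_zero_of_mulVec_eq_zero hdet h₀
      ext e
      simpa using congrFun h₁ (φ.symm e)
    · rw [h.vertexSet_eq] at hx hy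
      obtain ⟨p, -, hp⟩ := hT.exists_intCast_boundary_eq o hx hy
      refine ⟨Finsupp.equivFunOnFinite.symm
        (((hT.minorMatrix o h.le φ)⁻¹ *ᵥ p) ∘ φ.symm), ?_⟩
      rw [← hp, ← hT.minorMatrix_mulVec_eq_iff o h.le φ]
      simp [Function.comp_assoc, Matrix.mulVec_mulVec, Matrix.mul_nonsing_inv _ hu]

end Minors

end IsSpanningTree

end Graph

/-! ### The weighted Cauchy–Binet expansion over spanning trees. -/

namespace Graph

variable {α : Type u} {β : Type v} {G T T' : Graph α β}

lemma IsSpanningTree.eq_of_edgeSet_eq (hT : T.IsSpanningTree G) (hT' : T'.IsSpanningTree G) (h : E(T) = E(T')) :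
    T = T' :=
  (Compatible.of_le_le hT.spanning.le hT'.spanning.le).ext
    (hT.spanning.vertexSet_eq.trans hT'.spanning.vertexSet_eq.symm) h

lemma finite_setOf_isSpanningTree (G : Graph α β) [Finite E(G)] :
    {T : Graph α β | T.IsSpanningTree G}.Finite := by
  refine Set.Finite.of_injOn (f := fun T => E(T)) (t := 𝒫 E(G)) (fun T hT => hT.edgeSet_subset)
    (fun T hT T' hT' h => ?_) (Set.toFinite E(G)).finite_subsets
  exact hT.eq_of_edgeSet_eq hT' h

namespace IsSpanningTree

lemma sum_edgeSet_eq (hT : T.IsSpanningTree G) [Fintype E(G)] [Fintype E(T)]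
    [Fintype ↥(E(G) \ E(T))] {M : Type*} [AddCommMonoid M] (F : E(G) → M) :
    ∑ e, F e = ∑ e : E(T), F (Set.inclusion hT.edgeSet_subset e) +
      ∑ e : ↥(E(G) \ E(T)), F ⟨e, e.2.1⟩ := by
  classical
  rw [← (Equiv.Set.sumDiffSubset hT.edgeSet_subset).sum_comp, Fintype.sum_sum_type]
  rfl

lemma retract_inclusion (hT : T.IsSpanningTree G) (o : G.Orientation) (e : E(T)) :
    hT.retract o (Set.inclusion hT.edgeSet_subset e) = Finsupp.single e 1 := by
  rw [retract, dif_pos (show (Set.inclusion hT.edgeSet_subset e : β) ∈ E(T) from e.2)]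

lemma retract_of_notMem (hT : T.IsSpanningTree G) (o : G.Orientation) (e : ↥(E(G) \ E(T))) :
    hT.retract o ⟨e, e.2.1⟩ = -hT.edgeReturn o e :=
  dif_neg e.2.2

lemma returnMatrix_apply (hT : T.IsSpanningTree G) (o : G.Orientation) (f : E(T))
    (e : ↥(E(G) \ E(T))) : hT.returnMatrix o f e = hT.edgeReturn o e f := by
  simp [returnMatrix, returnMap]

open Classical in
/-- Edges in `T` have weight `1` and edges outside `T` have weight `t`. -/
noncomputable def edgeWeight (T : Graph α β) (t : ℝ) (e : β) : ℝ :=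
  if e ∈ E(T) then 1 else t

/-- The columns on `T` form the identity and contribute `1`; those outside form `-Y` with weight
`t`, and the signs cancel. -/
lemma retractMatrix_mul_diagonal_mul_transpose (hT : T.IsSpanningTree G) (o : G.Orientation)
    [Fintype E(G)] [DecidableEq E(G)] [Fintype E(T)] [DecidableEq E(T)] [Fintype ↥(E(G) \ E(T))]
    (t : ℝ) :
    hT.retractMatrix o * Matrix.diagonal (fun e : E(G) => edgeWeight T t e) *
      (hT.retractMatrix o)ᵀ = 1 + (t • hT.returnMatrix o) * (hT.returnMatrix o)ᵀ := by
  ext i j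
  rw [Matrix.mul_apply, hT.sum_edgeSet_eq, Matrix.add_apply, Matrix.mul_apply]
  congr 1
  · simp [retractMatrix, retract_inclusion, edgeWeight, Finsupp.single_apply, Matrix.one_apply,
      eq_comm]
  · refine Finset.sum_congr rfl fun e _ => ?_
    simp [retractMatrix, retract_of_notMem, edgeWeight, e.2.2, returnMatrix_apply, mul_comm]

lemma prod_edgeWeight (h : T' ≤ G) [Fintype E(T')] (t : ℝ) :
    ∏ e : E(T'), edgeWeight T t e = t ^ (E(T') ∩ (E(G) \ E(T))).ncard := by
  classical
  have hc : (E(T') ∩ (E(G) \ E(T))).ncard =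
      (Finset.univ.filter fun e : E(T') => (e : β) ∉ E(T)).card := by
    rw [← Set.ncard_coe_finset, ← Set.ncard_image_of_injective _ Subtype.val_injective]
    congr 1
    ext e
    simp only [Set.mem_inter_iff, Set.mem_sdiff, Finset.coe_filter, Finset.mem_univ, true_and,
      Set.mem_image, Set.mem_ofPred_eq, Subtype.exists, exists_and_left, exists_prop,
      exists_eq_right_right]
    exact ⟨fun ⟨h₁, _, h₂⟩ => ⟨h₂, h₁⟩,
      fun ⟨h₂, h₁⟩ => ⟨h₁, IsSubgraph.edgeSet_mono h h₁, h₂⟩⟩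
  simp only [edgeWeight]
  rw [Finset.prod_ite, Finset.prod_const_one, one_mul, Finset.prod_const, hc]

open Classical in
/-- The contribution of a map from the edges of `T` to the edges of `G` to the Cauchy–Binet
expansion: only the enumerations of the edges of spanning trees matter. -/
lemma prod_edgeWeight_mul_det_sq (hT : T.IsSpanningTree G) (o : G.Orientation)
    [Fintype E(T)] (t : ℝ) (𝒯 : Finset (Graph α β)) (h𝒯 : ∀ S, S ∈ 𝒯 ↔ S.IsSpanningTree G)
    (f : E(T) → E(G)) :
    (∏ a, edgeWeight T t (f a)) * ((hT.retractMatrix o).submatrix id f).det ^ 2 =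
      ∑ S ∈ 𝒯, if Function.Injective f ∧ Set.range (fun a => (f a : β)) = E(S) then
        t ^ (E(S) ∩ (E(G) \ E(T))).ncard else 0 := by
  by_cases hdet : ((hT.retractMatrix o).submatrix id f).det = 0 ∧
      ∀ S ∈ 𝒯, ¬ (Function.Injective f ∧ Set.range (fun a => (f a : β)) = E(S))
  · rw [hdet.1, Finset.sum_eq_zero fun S hS => if_neg (hdet.2 S hS)]
    simp
  -- Outside the trivial case `f` enumerates a spanning tree: either this is given, or a nonzero
  -- minor forces it.
  have hex : ∃ S, S.IsSpanningTree G ∧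
      Function.Injective f ∧ Set.range (fun a => (f a : β)) = E(S) := by
    by_cases h₀ : ((hT.retractMatrix o).submatrix id f).det = 0
    · simp only [h₀, true_and, not_forall, not_not] at hdet
      obtain ⟨S, hS, h⟩ := hdet
      exact ⟨S, (h𝒯 S).1 hS, h⟩
    · have hf : Function.Injective f := fun a b hab => by
        by_contra hne
        exact h₀ (Matrix.det_zero_of_column_eq hne fun i => by simp [hab])
      have hle : G.restrict (Set.range fun a => (f a : β)) ≤s G := ⟨restrict_le, rfl⟩
      have hE : Set.range (fun a => (f a : β)) = E(G.restrict (Set.range fun a => (f a : β))) := by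
        rw [edgeSet_restrict, Set.inter_eq_right.2]
        rintro _ ⟨a, rfl⟩
        exact (f a).2
      refine ⟨_, ?_, hf, hE⟩
      let φ := (Equiv.ofInjective _ (Subtype.val_injective.comp hf)).trans (Equiv.setCongr hE)
      exact hT.isSpanningTree_of_det_minorMatrix_ne_zero hle o φ h₀
  obtain ⟨S, hS, hf, hE⟩ := hex
  -- A spanning tree is determined by its edges, so a single summand survives.
  rw [Finset.sum_eq_single S, if_pos ⟨hf, hE⟩]
  · let φ := (Equiv.ofInjective _ (Subtype.val_injective.comp hf)).trans (Equiv.setCongr hE)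
    have : Fintype E(S) := .ofEquiv _ φ
    rw [← prod_edgeWeight hS.spanning.le, ← φ.prod_comp]
    have h₁ := hT.det_minorMatrix_sq hS o φ
    change (∏ a, edgeWeight T t (f a)) * (hT.minorMatrix o hS.spanning.le φ).det ^ 2 = _
    rw [h₁, mul_one]
    rfl
  · intro S' hS' hne
    refine if_neg fun h => hne (((h𝒯 S').1 hS').eq_of_edgeSet_eq hS (h.2.symm.trans hE))
  · exact fun h => absurd ((h𝒯 S).2 hS) h

open Classical in
-- These maps are the bijections from the edges of `T` to those of `T'`, two sets of equal size. The
-- count cancels the factorial in `Matrix.factorial_mul_det_mul`.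
lemma card_enumerations (hT : T.IsSpanningTree G) (hS : T'.IsSpanningTree G) (o : G.Orientation)
    [Fintype E(T)] [Fintype E(G)] :
    (Finset.univ.filter fun f : E(T) → E(G) => Function.Injective f ∧
      Set.range (fun a => (f a : β)) = E(T')).card = (Fintype.card E(T)).factorial := by
  have : Fintype E(T') := .ofInjective _ (Set.inclusion_injective hS.edgeSet_subset)
  have hcard : Fintype.card E(T) = Fintype.card E(T') := by
    rw [← Nat.card_eq_fintype_card, ← Nat.card_eq_fintype_card, hT.natCard_edgeSet_eq hS o]
  rw [← Fintype.card_equiv (Fintype.equivOfCardEq hcard), ← Finset.card_univ]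
  symm
  refine Finset.card_nbij (fun φ a => Set.inclusion hS.edgeSet_subset (φ a)) ?_ ?_ ?_
  · intro φ _
    refine Finset.mem_filter.2 ⟨Finset.mem_univ _,
      (Set.inclusion_injective hS.edgeSet_subset).comp φ.injective, ?_⟩
    exact (φ.surjective.range_comp _).trans Subtype.range_coe
  · intro φ _ ψ _ h
    exact Equiv.ext fun a => Set.inclusion_injective hS.edgeSet_subset (congrFun h a)
  · intro f hf
    obtain ⟨-, hf, hE⟩ := Finset.mem_filter.1 hf
    exact ⟨(Equiv.ofInjective _ (Subtype.val_injective.comp hf)).trans (Equiv.setCongr hE),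
      Finset.mem_univ _, rfl⟩

/-- The weighted count of spanning trees as a determinant. -/
theorem det_one_add_smul_reducedMesh (hT : T.IsSpanningTree G) (o : G.Orientation)
    [Finite E(G)] [Fintype E(T)] [Fintype ↥(E(G) \ E(T))] [DecidableEq ↥(E(G) \ E(T))] (t : ℝ)
    (𝒯 : Finset (Graph α β)) (h𝒯 : ∀ S, S ∈ 𝒯 ↔ S.IsSpanningTree G) :
    (1 + t • hT.reducedMesh o).det = ∑ S ∈ 𝒯, t ^ (E(S) ∩ (E(G) \ E(T))).ncard := by
  classical
  have : Fintype E(G) := Fintype.ofFinite _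
  have h₀ : ((Fintype.card E(T)).factorial : ℝ) ≠ 0 := by
    exact_mod_cast Nat.factorial_ne_zero _
  apply mul_left_cancel₀ h₀
  -- Sylvester's identity passes from `Yᵗ Y` to `Y Yᵗ`, which is where the retraction matrix enters.
  rw [reducedMesh, ← Matrix.mul_smul, ← Matrix.det_one_add_mul_comm,
    ← hT.retractMatrix_mul_diagonal_mul_transpose, Matrix.factorial_mul_det_mul]
  have h₁ (f : E(T) → E(G)) :
      ((hT.retractMatrix o * Matrix.diagonal fun e : E(G) => edgeWeight T t e).submatrix
          id f).det * ((hT.retractMatrix o)ᵀ.submatrix f id).det =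
        (∏ a, edgeWeight T t (f a)) * ((hT.retractMatrix o).submatrix id f).det ^ 2 := by
    rw [← Matrix.transpose_submatrix, Matrix.det_transpose, sq, ← mul_assoc,
      ← Matrix.det_mul_row]
    congr 2
    ext i j
    simp [mul_comm]
  simp_rw [h₁, hT.prod_edgeWeight_mul_det_sq o t 𝒯 h𝒯]
  rw [Finset.sum_comm, Finset.mul_sum]
  refine Finset.sum_congr rfl fun S hS => ?_
  rw [← Finset.sum_filter, Finset.sum_const, hT.card_enumerations ((h𝒯 S).1 hS) o, nsmul_eq_mul]

lemma numSpanningTreesOff_eq_card (T : Graph α β) [Finite E(G)] (𝒯 : Finset (Graph α β))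
    (h𝒯 : ∀ S, S ∈ 𝒯 ↔ S.IsSpanningTree G) (j : ℕ) :
    G.numSpanningTreesOff T j = (𝒯.filter fun S => (E(S) ∩ (E(G) \ E(T))).ncard = j).card := by
  rw [numSpanningTreesOff, ← Set.ncard_coe_finset]
  simp [h𝒯]

theorem det_one_add_smul_reducedMesh_eq_sum (hT : T.IsSpanningTree G) (o : G.Orientation)
    [Finite E(G)] [Fintype E(T)] [Fintype ↥(E(G) \ E(T))] [DecidableEq ↥(E(G) \ E(T))] (t : ℝ) :
    (1 + t • hT.reducedMesh o).det = ∑ j ∈ Finset.range ((E(G) \ E(T)).ncard + 1),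
      (G.numSpanningTreesOff T j : ℝ) * t ^ j := by
  have hfin := G.finite_setOf_isSpanningTree
  have h𝒯 (S : Graph α β) : S ∈ hfin.toFinset ↔ S.IsSpanningTree G := by simp
  rw [hT.det_one_add_smul_reducedMesh o t hfin.toFinset h𝒯,
    ← Finset.sum_fiberwise_of_maps_to (t := Finset.range ((E(G) \ E(T)).ncard + 1))
      (g := fun S => (E(S) ∩ (E(G) \ E(T))).ncard)
      fun S _ => Finset.mem_range.2 (Nat.lt_succ_of_le
        (Set.ncard_le_ncard Set.inter_subset_right (Set.toFinite _)))]
  refine Finset.sum_congr rfl fun j _ => ?_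
  rw [numSpanningTreesOff_eq_card T _ h𝒯, ← nsmul_eq_mul, ← Finset.sum_const]
  exact Finset.sum_congr rfl fun S hS => by rw [(Finset.mem_filter.1 hS).2]

end IsSpanningTree

lemma sum_numSpanningTreesOff (G T : Graph α β) [Finite E(G)] :
    ∑ j ∈ Finset.range ((E(G) \ E(T)).ncard + 1), G.numSpanningTreesOff T j =
      G.numSpanningTrees := by
  have hfin := G.finite_setOf_isSpanningTree
  have h𝒯 (S : Graph α β) : S ∈ hfin.toFinset ↔ S.IsSpanningTree G := by simp
  have hfin' : Finite ↥(E(G) \ E(T)) := Set.toFinite (E(G) \ E(T))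
  rw [numSpanningTrees, Set.ncard_eq_toFinset_card _ hfin,
    Finset.card_eq_sum_card_fiberwise (t := Finset.range ((E(G) \ E(T)).ncard + 1))
      (f := fun S => (E(S) ∩ (E(G) \ E(T))).ncard)
      fun S _ => Finset.mem_coe.2 (Finset.mem_range.2 (Nat.lt_succ_of_le
        (Set.ncard_le_ncard Set.inter_subset_right (Set.toFinite _))))]
  exact Finset.sum_congr rfl fun j _ => IsSpanningTree.numSpanningTreesOff_eq_card T _ h𝒯 j

/-! ### The mesh matrix and its characteristic polynomial. -/

namespace IsSpanningTree

lemma finite_edgeSet (hT : T.IsSpanningTree G) [Finite E(T)] [Finite ↥(E(G) \ E(T))] :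
    Finite E(G) := by
  rw [← Set.union_sdiff_cancel hT.edgeSet_subset]
  infer_instance

variable [Fintype E(T)] [Fintype ↥(E(G) \ E(T))] [DecidableEq ↥(E(G) \ E(T))]

/-- This is the constant term of the determinant identity, read off at `t = 0`. -/
lemma numSpanningTreesOff_zero (hT : T.IsSpanningTree G) (o : G.Orientation) :
    G.numSpanningTreesOff T 0 = 1 := by
  have := hT.finite_edgeSet
  have h := hT.det_one_add_smul_reducedMesh_eq_sum o 0
  rw [zero_smul, add_zero, Matrix.det_one, Finset.sum_range_succ', Finset.sum_eq_zero
    fun j _ => by simp] at h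
  simpa using h.symm

theorem charpoly_reducedMesh (hT : T.IsSpanningTree G) (o : G.Orientation) :
    (hT.reducedMesh o).charpoly = G.spanningTreePoly T := by
  have := hT.finite_edgeSet
  have hN : (E(G) \ E(T)).ncard = Fintype.card ↥(E(G) \ E(T)) := by
    rw [← Nat.card_coe_set_eq, Nat.card_eq_fintype_card]
  -- It suffices to compare values at `x ≠ 0`, where `t = -1/x` makes sense and `det (x Id - Mesh^#)
  -- = x^N det (Id + t Mesh^#)`.
  refine Polynomial.eq_of_infinite_eval_eq _ _
    ((Set.finite_singleton (0 : ℝ)).infinite_compl.mono fun x hx => ?_)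
  have hx : x ≠ 0 := hx
  have h₁ : Matrix.scalar _ x - hT.reducedMesh o = x • (1 + (-x⁻¹) • hT.reducedMesh o) := by
    rw [smul_add, smul_smul, mul_neg, mul_inv_cancel₀ hx, neg_one_smul, ← sub_eq_add_neg,
      Matrix.smul_one_eq_diagonal]
    rfl
  simp only [Set.mem_ofPred_eq, Matrix.eval_charpoly, h₁, Matrix.det_smul,
    hT.det_one_add_smul_reducedMesh_eq_sum, spanningTreePoly, Polynomial.eval_finsetSum, ← hN,
    Finset.mul_sum]
  refine Finset.sum_congr rfl fun j hj => ?_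
  have hj : j ≤ (E(G) \ E(T)).ncard := Nat.lt_succ_iff.1 (Finset.mem_range.1 hj)
  obtain ⟨k, hk⟩ := Nat.exists_eq_add_of_le hj
  rw [hk, Nat.add_sub_cancel_left]
  simp only [Polynomial.eval_mul, Polynomial.eval_pow, Polynomial.eval_neg, Polynomial.eval_one,
    Polynomial.eval_natCast, Polynomial.eval_X]
  rw [neg_pow, inv_pow, pow_add]
  field_simp

/-- On the edges of `T` the coordinates of `Z[e]` form a column of `Y`; on the other edges they form
a standard basis vector. Splitting the pairing accordingly gives the two summands. -/
theorem mesh_eq (hT : T.IsSpanningTree G) (o : G.Orientation) :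
    hT.mesh o = 1 + (hT.returnMatrix o)ᵀ * hT.returnMatrix o := by
  have := hT.finite_edgeSet
  have : Fintype E(G) := Fintype.ofFinite _
  have hin (e : ↥(E(G) \ E(T))) (f : E(T)) :
      hT.cycle o e (Set.inclusion hT.edgeSet_subset f) = hT.returnMatrix o f e := by
    rw [cycle, Finsupp.add_apply,
      Finsupp.mapDomain_apply (Set.inclusion_injective hT.edgeSet_subset),
      Finsupp.single_eq_of_ne, zero_add]
    · rfl
    · exact fun h => e.2.2 ((congrArg Subtype.val h) ▸ f.2)
  have hout (e e' : ↥(E(G) \ E(T))) :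
      hT.cycle o e ⟨e', e'.2.1⟩ = (1 : Matrix ↥(E(G) \ E(T)) ↥(E(G) \ E(T)) ℝ) e e' := by
    classical
    rw [cycle, Finsupp.add_apply, Finsupp.mapDomain_of_notMem_range, add_zero, Matrix.one_apply,
      Finsupp.single_apply]
    · exact if_congr (by rw [Subtype.ext_iff, Subtype.ext_iff]) rfl rfl
    · rintro ⟨f, hf⟩
      exact e'.2.2 ((congrArg Subtype.val hf) ▸ f.2)
  ext e e'
  rw [mesh, Matrix.of_apply, Chain.pairing, Finsupp.sum_fintype _ _ (by simp),
    hT.sum_edgeSet_eq, Matrix.add_apply, add_comm, Matrix.mul_apply]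
  simp only [hin, hout, Matrix.transpose_apply]
  congr 1
  simp [Matrix.one_apply]

end IsSpanningTree

end Graph

theorem theorem2p2 {α : Type u} {β : Type v} [DecidableEq β]
    (G T₀ : Graph α β) [Finite ↥V(G)] [Fintype ↥E(T₀)] [Fintype ↥(E(G) \ E(T₀))]
    (hG : G.IsConnected) (hT₀ : T₀.IsSpanningTree G) (o : G.Orientation)
    (N : ℕ) (hN : N = (E(G) \ E(T₀)).ncard) :
    -- the mesh matrix is `Id + Yᵗ Y`
    hT₀.mesh o = 1 + (hT₀.returnMatrix o)ᵀ * hT₀.returnMatrix o ∧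
    -- all complex eigenvalues of the reduced mesh matrix are real and nonnegative
    (∀ μ : ℂ, Module.End.HasEigenvalue
        (Matrix.toLin' ((hT₀.reducedMesh o).map (algebraMap ℝ ℂ))) μ →
      ∃ r : ℝ, 0 ≤ r ∧ μ = (r : ℂ)) ∧
    -- all complex eigenvalues of the mesh matrix are real and at least `1`
    (∀ μ : ℂ, Module.End.HasEigenvalue
        (Matrix.toLin' ((hT₀.mesh o).map (algebraMap ℝ ℂ))) μ →
      ∃ r : ℝ, 1 ≤ r ∧ μ = (r : ℂ)) ∧
    -- `det ((U + 1) Id - Mesh) = det (U Id - Mesh^#)`, as polynomials in `U`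
    (Matrix.scalar ↥(E(G) \ E(T₀)) (Polynomial.X + 1 : ℝ[X]) -
        (hT₀.mesh o).map Polynomial.C).det =
      (hT₀.reducedMesh o).charpoly ∧
    -- `det (U Id - Mesh^#) = U^N + ∑_{j=1}^N (-1)^j ST_j(G, T₀) U^{N-j}`
    (hT₀.reducedMesh o).charpoly =
      Polynomial.X ^ N + ∑ j ∈ Finset.Icc 1 N,
        (-1) ^ j * (G.numSpanningTreesOff T₀ j : ℝ[X]) * Polynomial.X ^ (N - j) ∧
    -- `det (U Id - Mesh^#) = ST(G, T₀)(U)`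
    (hT₀.reducedMesh o).charpoly = G.spanningTreePoly T₀ ∧
    -- `det (X Id - Mesh) = ST(G, T₀)(X - 1)`
    (hT₀.mesh o).charpoly = (G.spanningTreePoly T₀).comp (Polynomial.X - 1) ∧
    -- `det Mesh = ∑_{j=0}^N ST_j(G, T₀) = ST(G)`
    (hT₀.mesh o).det = ∑ j ∈ Finset.range (N + 1), (G.numSpanningTreesOff T₀ j : ℝ) ∧
    ∑ j ∈ Finset.range (N + 1), G.numSpanningTreesOff T₀ j = G.numSpanningTrees := by
  subst hN
  have := hT₀.finite_edgeSet
  have hmesh := hT₀.mesh_eq o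
  have hmesh' : hT₀.mesh o = 1 + hT₀.reducedMesh o := hmesh
  have hchar := hT₀.charpoly_reducedMesh o
  refine ⟨hmesh, fun μ hμ => Matrix.exists_nonneg_of_hasEigenvalue_transpose_mul_self _ μ hμ,
    fun μ hμ => Matrix.exists_one_le_of_hasEigenvalue_one_add _ μ (hmesh ▸ hμ), ?_, ?_, hchar, ?_,
    ?_, G.sum_numSpanningTreesOff T₀⟩
  · rw [hmesh', Matrix.charpoly, Matrix.charmatrix, Matrix.map_add _ (map_add _),
      Matrix.map_one _ (map_zero _) (map_one _), map_add, map_one, add_comm 1,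
      add_sub_add_right_eq_sub]
    rfl
  -- The summand `j = 0` is `U^N` because `ST_0 = 1`.
  · rw [hchar, Graph.spanningTreePoly, Finset.range_eq_Ico,
      Finset.sum_eq_sum_Ico_succ_bot (Nat.succ_pos _), hT₀.numSpanningTreesOff_zero o]
    simp [Finset.Ico_add_one_right_eq_Icc]
  · rw [← hchar, hmesh']
    refine Polynomial.funext fun x => ?_
    rw [Polynomial.eval_comp, Matrix.eval_charpoly, Matrix.eval_charpoly, Polynomial.eval_sub,
      Polynomial.eval_X, Polynomial.eval_one, map_sub, map_one, sub_sub]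
  -- At `t = 1` the matrix `Id + t Mesh^#` is the mesh matrix itself.
  · have h := hT₀.det_one_add_smul_reducedMesh_eq_sum o 1
    rw [one_smul, ← hmesh'] at h
    simpa using h
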